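/- **Setting.** Let $G=(X,A)$ be a finite simple graph with arc set $A$ (each edge gives two mutually inverse arcs $e,\bar e$), with a rotation $\rho$ (a permutation of $A$ that permutes cyclically, for every vertex $x$, the arcs with terminus $x$) and a twist $\tau:A\to\mathbb Z_2$ with $\tau(\bar e)=\tau(e)$. The double cover $G^\tau$ has vertices $X\times\mathbb Z_2$ and arcs from $(x,j)$ to $(y,j+\tau(x,y))$ for $(x,y)\in A$; it carries the rotation $\tilde\rho$ equal to $\rho$ at the vertices $(x,0)$ and to $\rho^{-1}$ at the vertices $(x,1)$, and $\tau$ is pulled back to its arcs. The blow-up graph $G(\rho,\tau)$ has the arcs of $G^\tau$ as vertices, and for each such $e$ an island arc $(e,\tilde\rho(e))$ and a bridge arc $(e,\bar e)$. Choose a set $\delta A_{is}$ of island arcs; subdivide each $\xi\in\delta A_{is}$ into $\xi^-,\xi^+$ by a new boundary vertex $x_\xi$ and attach at $x_\xi$ a semi-infinite path (tail) with inward arcs $e_0,e_1,\dots$ ($e_0$ ends at $x_\xi$) and outward arcs $\bar e_0,\bar e_1,\dots$. Let $\delta X$ be the set of boundary vertices. The tail assignment is called hedgehog if every island arc is in $\delta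 A_{is}$. Let $C=\begin{bmatrix}a&b\\c&d\end{bmatrix}$ be a unitary matrix. One step of the walk, on complex functions $\Psi$ on the arcs, is as follows. At every vertex, if $p$ is the amplitude on the incoming island arc and $q$ the amplitude on the incoming bridge (or inward tail) arc, the outgoing island arc receives $ap+bq$ and the outgoing bridge (or outward tail) arc receives $\pm(cp+dq)$, with sign $(-1)^{\tau}$ on a bridge of type $\tau$ and $+$ on a tail; on the rest of the tails the motion is free, $\Psi_{t+1}(e_j)=\Psi_t(e_{j+1})$, $\Psi_{t+1}(\bar e_{j+1})=\Psi_t(\bar e_j)$. For $\alpha\in\mathbb C^{\delta X}$, $\Psi_0$ equals $\alpha(x)$ on all inward arcs of the tail at $x$ and $0$ elsewhere. The scattering matrix $S$ on $\mathbb C^{\delta X}$ is the matrix such that for every $\alpha$ the limit $\Psi_\infty=\lim_t\Psi_t$ exists on every arc and $\beta_{out}=S\alpha_{in}$, where $\alpha_{in}(x)=\Psi_\infty(e_0)$ and $\beta_{out}(x)=\Psi_\infty(\bar e_0)$ for the tail at $x$. Let $F$ be the set of faces of $(G^\tau,\tilde\rho)$, i.e. the cyclic sequences $f=(e_0,\dots,e_{\kappa-1})$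 of arcs of $G^\tau$ with $e_{j+1}=\overline{\tilde\rho(e_j)}$ (the cycles of this permutation). Along $f$ one passes through the island arcs $\xi_{j+1}=(e_j,\tilde\rho(e_j))$, and the bridge representing $e_j$ leads from $\xi_j$ to $\xi_{j+1}$; every island arc lies on exactly one face. For $f\in F$ let $x_{k_0},\dots,x_{k_{q-1}}$ be the boundary vertices on $f$ in their cyclic order, $x_{k_j}$ lying on $\xi_{k_j}$. On $\mathbb C^{\{0,\dots,q-1\}}$ let $I_f$ be the identity and $$(P_f(\omega)h)(j)=(-1)^{\bowtie_f(j,j-1)}\,\omega^{\mathrm{dist}_f(j,j-1)}\,h(j-1)\qquad(j \bmod q),$$ where $\mathrm{dist}_f(j,j-1)\in\{1,\dots,\kappa\}$ is the number of bridges passed along $f$ from $x_{k_{j-1}}$ to the next boundary vertex $x_{k_j}$ (it is $\kappa$ if $q=1$), and $\bowtie_f(j,j-1)$ is the parity of the number of those that have type $1$. **Theorem.** Assume $d\in\mathbb R$ and put $\omega=-\det C$. Then the scattering matrix exists, is unique, and is the direct sum $$S=\bigoplus_{f\in F}S_f,\qquad S_f=bc\,P_f(\omega)\,(I_f-aP_f(\omega))^{-1}+d\,I_f,$$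 where all $P_f(\omega)$ and all $S_f$ are unitary, and $I_f-aP_f(\omega)$ is invertible if $bc\ne0$ (if $bc=0$ the first term of $S_f$ is read as $0$). In the hedgehog case, with the unitary matrix $P_f$ given by $(P_fh)(j)=(-1)^{\tau(e_{j-1})}h(j-1)$, $j\in\mathbb Z/|f|$, this becomes $$S_f=bc\,\omega\,P_f\,(I_f-a\omega P_f)^{-1}+d\,I_f,$$ with $I_f-a\omega P_f$ invertible if $bc\ne0$. -/

import Mathlib

open scoped Classical Topology

/-- A rotation system on a simple graph `G`: the arcs are the darts of `G`, `rot` permutes cyclically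
the arcs with a given terminus, and `twist` is the type (`0` or `1`) of the underlying edge. -/
structure RotationSystem {V : Type*} (G : SimpleGraph V) where
  rot : Equiv.Perm G.Dart
  rot_cyclic : ∀ x : V, rot.IsCycleOn {e : G.Dart | e.snd = x}
  twist : G.Dart → ZMod 2
  twist_symm : ∀ e : G.Dart, twist e.symm = twist e

namespace RotationSystem

noncomputable section

variable {V : Type*} {G : SimpleGraph V} (R : RotationSystem G)

theorem add_add_self (k t : ZMod 2) : k + t + t = k := by
  rw [add_assoc, CharTwo.add_self_eq_zero, add_zero]

/-- The double covering graph `G^τ`. -/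
def cover : SimpleGraph (V × ZMod 2) where
  Adj u v := ∃ h : G.Adj u.1 v.1, v.2 = u.2 + R.twist ⟨(u.1, v.1), h⟩
  symm := by
    refine ⟨?_⟩
    rintro u v ⟨h, hk⟩
    refine ⟨h.symm, ?_⟩
    have ht : R.twist ⟨(v.1, u.1), h.symm⟩ = R.twist ⟨(u.1, v.1), h⟩ :=
      R.twist_symm ⟨(u.1, v.1), h⟩
    rw [ht, hk, add_add_self]
  loopless := ⟨fun _ h => G.loopless.irrefl _ h.1⟩

/-- The arcs of the double covering graph. These are the vertices of the blow-up graph `G(ρ,τ)`. -/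
abbrev Arc : Type _ := R.cover.Dart

/-- The arc of `G` below an arc of the double covering graph. -/
def proj (e : R.Arc) : G.Dart := ⟨(e.fst.1, e.snd.1), e.adj.1⟩

/-- The lift of an arc of `G` whose terminus lies in sheet `k`. -/
def lift (e : G.Dart) (k : ZMod 2) : R.Arc :=
  ⟨((e.fst, k + R.twist e), (e.snd, k)), ⟨e.adj, (add_add_self k (R.twist e)).symm⟩⟩

theorem proj_lift (e : G.Dart) (k : ZMod 2) : R.proj (R.lift e k) = e := rfl

theorem lift_snd_snd (e : G.Dart) (k : ZMod 2) : (R.lift e k).snd.2 = k := rfl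

theorem lift_proj (e : R.Arc) : R.lift (R.proj e) e.snd.2 = e := by
  apply SimpleGraph.Dart.ext
  obtain ⟨h, hk⟩ := e.adj
  refine Prod.ext (Prod.ext rfl ?_) rfl
  change e.snd.2 + R.twist (R.proj e) = e.fst.2
  have hk' : e.snd.2 = e.fst.2 + R.twist (R.proj e) := hk
  rw [hk', add_add_self]

/-- The rotation `ρ ⊕ ρ⁻¹` of the double covering graph: `ρ` at the vertices of sheet `0` and `ρ⁻¹`
at the vertices of sheet `1`. -/
def coverRot : Equiv.Perm R.Arc where
  toFun e := R.lift (if e.snd.2 = 0 then R.rot (R.proj e) else R.rot.symm (R.proj e)) e.snd.2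
  invFun e := R.lift (if e.snd.2 = 0 then R.rot.symm (R.proj e) else R.rot (R.proj e)) e.snd.2
  left_inv e := by
    conv_rhs => rw [← R.lift_proj e]
    simp only [proj_lift, lift_snd_snd]
    split_ifs <;> simp
  right_inv e := by
    conv_rhs => rw [← R.lift_proj e]
    simp only [proj_lift, lift_snd_snd]
    split_ifs <;> simp

/-- The type of the edge of `G` below an arc of the double covering graph. -/
def coverTwist (e : R.Arc) : ZMod 2 := R.twist (R.proj e)

/-- The facial permutation `σ ∘ (ρ ⊕ ρ⁻¹)` on the arcs of the double covering graph, where `σ`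
reverses arcs. -/
def facePerm : Equiv.Perm R.Arc :=
  R.coverRot.trans (SimpleGraph.Dart.symm_involutive (G := R.cover)).toPerm

/-- The faces: the facial walks of `(G^τ, ρ ⊕ ρ⁻¹, id)` up to the choice of the starting arc. -/
def Face : Type _ := Quotient (Equiv.Perm.SameCycle.setoid R.facePerm)

/-- The face whose facial walk contains the arc `e`. In the extended facial walk, the bridge
representing `e` (it ends at the vertex `e` of the blow-up graph) is followed by the island arc
`(e, ρ e)`, so this is also the face passing through that island arc. -/
def face (e : R.Arc) : R.Face := Quotient.mk _ e

/-- The arcs of the blow-up graph with tails. The island arc `(e, ρ e)` is named by its origin `e`,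
and `δ` is the set of (names of) those island arcs into which a tail is inserted. -/
inductive TailedArc (δ : Finset R.Arc) : Type _
  /-- the island arc from `e` to `ρ e`, carrying no tail -/
  | island (e : R.Arc) (he : e ∉ δ)
  /-- the quay `ξ⁻` from `e` to the boundary vertex of the divided island arc `ξ = (e, ρ e)` -/
  | quayIn (x : δ)
  /-- the quay `ξ⁺` from the boundary vertex of the divided island arc `ξ = (e, ρ e)` to `ρ e` -/
  | quayOut (x : δ)
  /-- the bridge arc from `e` to the inverse arc of `e` -/
  | bridge (e : R.Arc)
  /-- the tail arc `e_j`, directed towards the boundary vertex; `e_0` ends there -/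
  | tailIn (x : δ) (j : ℕ)
  /-- the tail arc inverse to `e_j`, directed away from the boundary vertex -/
  | tailOut (x : δ) (j : ℕ)

variable {R}

/-- The arc with which the (possibly divided) island arc `(e, ρ e)` starts, leaving `e`. -/
def islandStart (δ : Finset R.Arc) (e : R.Arc) : R.TailedArc δ :=
  if h : e ∈ δ then .quayIn ⟨e, h⟩ else .island e h

/-- The arc with which the (possibly divided) island arc `(e, ρ e)` ends, entering `ρ e`. -/
def islandEnd (δ : Finset R.Arc) (e : R.Arc) : R.TailedArc δ :=
  if h : e ∈ δ then .quayOut ⟨e, h⟩ else .island e h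

/-- The amplitude sent at a vertex `e` of the blow-up graph into the island arc that starts there:
`a` times the amplitude on the island arc entering `e` plus `b` times that on the bridge
entering `e`. -/
def toIsland (C : Matrix (Fin 2) (Fin 2) ℂ) (δ : Finset R.Arc) (Ψ : R.TailedArc δ → ℂ)
    (e : R.Arc) : ℂ :=
  C 0 0 * Ψ (islandEnd δ (R.coverRot.symm e)) + C 0 1 * Ψ (.bridge e.symm)

/-- The time evolution operator of the walk on the blow-up graph with tails: the coin
`C = [[a, b], [c, d]]` acts at every vertex of the interior and at every boundary vertex, twisted
bridges change the sign, and the dynamics on the tails is free. -/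
def evolve (C : Matrix (Fin 2) (Fin 2) ℂ) (δ : Finset R.Arc) (Ψ : R.TailedArc δ → ℂ) :
    R.TailedArc δ → ℂ
  | .island e _ => toIsland C δ Ψ e
  | .quayIn x => toIsland C δ Ψ x
  | .quayOut x => C 0 0 * Ψ (.quayIn x) + C 0 1 * Ψ (.tailIn x 0)
  | .bridge e => (-1) ^ (R.coverTwist e).val *
      (C 1 0 * Ψ (islandEnd δ (R.coverRot.symm e)) + C 1 1 * Ψ (.bridge e.symm))
  | .tailIn x j => Ψ (.tailIn x (j + 1))
  | .tailOut x 0 => C 1 0 * Ψ (.quayIn x) + C 1 1 * Ψ (.tailIn x 0)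
  | .tailOut x (j + 1) => Ψ (.tailOut x j)

/-- The initial state with inflow `α`. -/
def initialState (δ : Finset R.Arc) (α : δ → ℂ) : R.TailedArc δ → ℂ
  | .tailIn x _ => α x
  | _ => 0

/-- `Ψ` is the stationary state (the pointwise limit of the walk) for the inflow `α`. -/
def IsStationaryState (C : Matrix (Fin 2) (Fin 2) ℂ) (δ : Finset R.Arc) (α : δ → ℂ)
    (Ψ : R.TailedArc δ → ℂ) : Prop :=
  ∀ ξ : R.TailedArc δ,
    Filter.Tendsto (fun t : ℕ => (evolve C δ)^[t] (initialState δ α) ξ) Filter.atTop (𝓝 (Ψ ξ))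

/-- `S` is the scattering matrix: for every inflow the walk converges to a stationary state, and
`S` maps the incoming amplitudes of the stationary state at the boundary vertices to the outgoing
ones. -/
def IsScatteringMatrix (C : Matrix (Fin 2) (Fin 2) ℂ) (δ : Finset R.Arc) (S : Matrix δ δ ℂ) :
    Prop :=
  ∀ α : δ → ℂ, ∃ Ψ : R.TailedArc δ → ℂ, IsStationaryState C δ α Ψ ∧
    (fun x : δ => Ψ (.tailOut x 0)) = S.mulVec (fun x : δ => Ψ (.tailIn x 0))

/-- The boundary vertices on the (extended) facial walk `f`. -/
abbrev FaceBoundary (δ : Finset R.Arc) (f : R.Face) : Type _ := {x : δ // R.face x = f}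

/-- `dist_f(x, y)`: the number of bridges passed when walking along the facial walk from the island
arc named `y` to the island arc named `x`; it is the full length of the walk if `x = y`. -/
def walkDist (x y : R.Arc) : ℕ := sInf {n : ℕ | 0 < n ∧ (R.facePerm ^ n) y = x}

/-- The parity of the number of twisted bridges passed when walking along the facial walk from the
island arc named `y` to the island arc named `x`. -/
def walkTwist (x y : R.Arc) : ZMod 2 :=
  ∑ i ∈ Finset.range (walkDist x y), R.coverTwist ((R.facePerm ^ (i + 1)) y)

/-- The boundary vertex `x` is the first one met on the facial walk `f` after `y`. -/
def IsNext (δ : Finset R.Arc) {f : R.Face} (x y : FaceBoundary δ f) : Prop :=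
  ∀ n : ℕ, 0 < n → n < walkDist (x.1 : R.Arc) y.1 → (R.facePerm ^ n) (y.1 : R.Arc) ∉ δ

/-- The weighted cyclic permutation matrix `P_f(ω)`. -/
def faceMatrix (δ : Finset R.Arc) (f : R.Face) (ω : ℂ) :
    Matrix (FaceBoundary δ f) (FaceBoundary δ f) ℂ :=
  Matrix.of fun x y =>
    if IsNext δ x y then
      (-1) ^ (walkTwist (x.1 : R.Arc) y.1).val * ω ^ walkDist (x.1 : R.Arc) y.1
    else 0

/-- The signed cyclic permutation matrix `P_f` of the hedgehog case:
`(P_f h)(j) = (-1) ^ τ(e_{j-1}) h(j-1)`. -/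
def hedgehogMatrix (δ : Finset R.Arc) (f : R.Face) :
    Matrix (FaceBoundary δ f) (FaceBoundary δ f) ℂ :=
  Matrix.of fun x y =>
    if (x.1 : R.Arc) = R.facePerm y.1 then (-1) ^ (R.coverTwist (x.1 : R.Arc)).val else 0

/-- The direct sum over all faces of matrices on the boundary vertices of the faces, as a matrix on
the set of all boundary vertices. -/
def faceSum (δ : Finset R.Arc)
    (S : (f : R.Face) → Matrix (FaceBoundary δ f) (FaceBoundary δ f) ℂ) : Matrix δ δ ℂ :=
  Matrix.reindex (Equiv.sigmaFiberEquiv fun x : δ => R.face x)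
    (Equiv.sigmaFiberEquiv fun x : δ => R.face x) (Matrix.blockDiagonal' S)

end

end RotationSystem

/-! Two facts carry the theorem. The first is convergence. The coins are unitary, so the energy of
the finite interior changes in each step by inflow minus outflow. Interior states that never leak
into the tails may exist, but the inflow cannot excite them; on their orthogonal complement the
undriven evolution dies out, so the driven one converges (`exists_tendsto_iterate_of_energy`, fed by
`energy_evolve`).

The second is that in a stationary state a bridge does not reflect when `d` is real. Unitarity then
gives `a = -ωd` and `bc = ω + ad = ω(1 - d²)`. If `bc ≠ 0`, summing the round trips on a bridge
gives the reflection coefficient `a + bcd/(1 - d²) = a + ωd = 0` and the transmission coefficient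
`±bc/(1 - d²) = ±ω` (`islandStart_facePerm`). Amplitudes thus follow the facial walks, and distinct
faces decouple.

On a face let `p`, `q` be the amplitudes on the quays entering and leaving the boundary vertices.
Then `p = P q`, `q = a p + b α` and `β = c p + d α`; eliminating `p` and `q` gives `S_f`. If `bc =
0` then `c = 0` and `β = d α`. Unitarity of `S_f` is that of the Möbius transform `(ωP + d)(1 +
dωP)⁻¹`. -/

/-! ### Convergence of driven contractions. -/

open Filter in
/-- A finite-dimensional contraction that is part of an isometric scattering system: starting from
the zero state, the states driven by a constant inflow converge. -/
theorem exists_tendsto_iterate_of_energy {H K K' : Type*} [NormedAddCommGroup H]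
    [InnerProductSpace ℂ H] [FiniteDimensional ℂ H] [NormedAddCommGroup K] [NormedSpace ℂ K]
    [NormedAddCommGroup K'] [NormedSpace ℂ K']
    (A : H →ₗ[ℂ] H) (B : K →ₗ[ℂ] H) (D : H →ₗ[ℂ] K') (E : K →ₗ[ℂ] K')
    (h : ∀ x k, ‖A x + B k‖ ^ 2 + ‖D x + E k‖ ^ 2 = ‖x‖ ^ 2 + ‖k‖ ^ 2) (k : K) :
    ∃ y, Tendsto (fun t : ℕ => (fun x => A x + B k)^[t] 0) atTop (𝓝 y) := by
  have hAD : ∀ x, ‖A x‖ ^ 2 + ‖D x‖ ^ 2 = ‖x‖ ^ 2 := fun x => by simpa using h x 0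
  have hBE : ‖B k‖ ^ 2 + ‖E k‖ ^ 2 = ‖k‖ ^ 2 := by simpa using h 0 k
  have hle : ∀ x, ‖A x‖ ≤ ‖x‖ := fun x =>
    le_of_sq_le_sq (by nlinarith [hAD x, sq_nonneg ‖D x‖]) (norm_nonneg x)
  -- the states that never lose energy
  let E₀ : Submodule ℂ H := ⨅ n : ℕ, LinearMap.ker (D ∘ₗ A ^ n)
  have hE₀ : ∀ x, x ∈ E₀ ↔ ∀ n : ℕ, D ((A ^ n) x) = 0 := fun x => by
    simp [E₀, Submodule.mem_iInf]
  have hE₀D : ∀ x ∈ E₀, D x = 0 := fun x hx => by simpa using (hE₀ x).1 hx 0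
  have hE₀norm : ∀ x ∈ E₀, ‖A x‖ = ‖x‖ := fun x hx => by
    have := hAD x
    rw [hE₀D x hx] at this
    simpa [sq_eq_sq₀] using this
  have hE₀A : ∀ x ∈ E₀, A x ∈ E₀ := fun x hx => (hE₀ _).2 fun n => by
    have := (hE₀ x).1 hx (n + 1)
    rwa [pow_succ] at this
  have hE₀surj : ∀ x ∈ E₀, ∃ x' ∈ E₀, A x' = x := by
    -- `A` is isometric on the finite-dimensional invariant space `E₀`, hence bijective there.
    have hinj : Function.Injective (A.restrict hE₀A) := by
      rw [← LinearMap.ker_eq_bot, LinearMap.ker_eq_bot']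
      intro x hx
      have h1 : A x.1 = 0 := congrArg Subtype.val hx
      have h2 := hE₀norm x.1 x.2
      rw [h1, norm_zero] at h2
      exact Subtype.ext (norm_eq_zero.1 h2.symm)
    intro x hx
    obtain ⟨x', hx'⟩ := LinearMap.injective_iff_surjective.1 hinj ⟨x, hx⟩
    exact ⟨x', x'.2, congrArg Subtype.val hx'⟩
  have horth : ∀ u v : H, (∀ z : ℂ, ‖z • u + v‖ ^ 2 = ‖z • u‖ ^ 2 + ‖v‖ ^ 2) →
      inner ℂ u v = 0 := by
    intro u v huv
    -- With this scalar the cross term becomes twice the squared modulus of the inner product.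
    have h1 := huv (inner ℂ u v)
    rw [norm_add_sq (𝕜 := ℂ), inner_smul_left, RCLike.conj_mul, add_left_inj,
      add_eq_left] at h1
    rw [← RCLike.ofReal_pow, RCLike.ofReal_re] at h1
    simpa using h1
  -- The map `w ↦ (A w, D w)` preserves inner products and sends `E₀` onto `E₀ × 0`, so the
  -- complement of `E₀` cannot re-enter it. The same reasoning, with `(B k, E k)`, keeps the inflow
  -- out of `E₀`.
  have horthA : ∀ w ∈ E₀ᗮ, A w ∈ E₀ᗮ := by
    intro w hw
    rw [Submodule.mem_orthogonal] at hw ⊢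
    intro u hu
    obtain ⟨u', hu', rfl⟩ := hE₀surj u hu
    apply horth
    intro z
    have h1 := hAD (z • u' + w)
    have h2 := hAD w
    have h3 := hE₀norm _ (E₀.smul_mem z hu')
    have h4 : ‖z • u' + w‖ ^ 2 = ‖z • u'‖ ^ 2 + ‖w‖ ^ 2 := by
      have := norm_add_sq_eq_norm_sq_add_norm_sq_of_inner_eq_zero (z • u') w
        (by rw [inner_smul_left, hw u' hu', mul_zero] : inner ℂ (z • u') w = 0)
      simpa [sq] using this
    rw [map_smul] at h3
    rw [map_add, map_add, map_smul, map_smul, hE₀D u' hu', smul_zero, zero_add] at h1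
    rw [h3]
    linarith
  have horthB : B k ∈ E₀ᗮ := by
    rw [Submodule.mem_orthogonal]
    intro u hu
    obtain ⟨u', hu', rfl⟩ := hE₀surj u hu
    apply horth
    intro z
    have h1 := h (z • u') k
    have h3 := hE₀norm _ (E₀.smul_mem z hu')
    rw [map_smul] at h3
    rw [map_smul, map_smul, hE₀D u' hu', smul_zero, zero_add] at h1
    rw [h3]
    linarith
  -- states orthogonal to `E₀` die out
  have hdecay : ∀ w ∈ E₀ᗮ, Tendsto (fun n : ℕ => (A ^ n) w) atTop (𝓝 0) := by
    intro w hw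
    have hmem : ∀ n : ℕ, (A ^ n) w ∈ E₀ᗮ := by
      intro n
      induction n with
      | zero => simpa using hw
      | succ n ih => rw [pow_succ']; exact horthA _ ih
    have hanti : Antitone fun n : ℕ => ‖(A ^ n) w‖ :=
      antitone_nat_of_succ_le fun n => by rw [pow_succ']; exact hle _
    obtain ⟨L, hL⟩ : ∃ L, Tendsto (fun n : ℕ => ‖(A ^ n) w‖) atTop (𝓝 L) :=
      ⟨_, tendsto_atTop_ciInf hanti ⟨0, by rintro _ ⟨n, rfl⟩; exact norm_nonneg _⟩⟩
    have : ProperSpace H := FiniteDimensional.proper ℂ H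
    -- A cluster point `z` of the orbit has all its iterates of the limiting norm `L`, so it never
    -- loses energy and lies in both `E₀` and `E₀ᗮ`.
    obtain ⟨z, -, φ, hφ, hz⟩ := (isCompact_closedBall (0 : H) ‖w‖).tendsto_subseq
      (x := fun n : ℕ => (A ^ n) w) (fun n => by
        rw [mem_closedBall_zero_iff]
        simpa using hanti (Nat.zero_le n))
    have hznorm : ∀ m : ℕ, ‖(A ^ m) z‖ = L := by
      intro m
      have h1 : Tendsto (fun n => ‖(A ^ m) ((A ^ φ n) w)‖) atTop (𝓝 ‖(A ^ m) z‖) :=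
        (((A ^ m).continuous_of_finiteDimensional.tendsto z).comp hz).norm
      refine tendsto_nhds_unique h1 ?_
      have h2 := hL.comp (tendsto_atTop_mono (fun n => Nat.le_add_left (φ n) m) hφ.tendsto_atTop)
      refine h2.congr fun n => ?_
      simp only [Function.comp, pow_add, Module.End.mul_apply]
    have hzE₀ : z ∈ E₀ := by
      rw [hE₀]
      intro n
      have h1 := hAD ((A ^ n) z)
      have h2 := hznorm (n + 1)
      rw [pow_succ'] at h2
      rw [hznorm n] at h1
      change ‖A ((A ^ n) z)‖ = L at h2
      rw [h2] at h1
      simpa using h1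
    have hzorth : z ∈ E₀ᗮ :=
      (Submodule.isClosed_orthogonal E₀).mem_of_tendsto hz (Eventually.of_forall fun n => hmem _)
    have hz0 : z = 0 := by
      have := Submodule.inner_right_of_mem_orthogonal hzE₀ hzorth
      simpa using this
    have hL0 : L = 0 := by
      rw [← hznorm 0, hz0]
      simp
    rw [tendsto_zero_iff_norm_tendsto_zero]
    rwa [hL0] at hL
  -- a stationary state orthogonal to `E₀`
  obtain ⟨y, hyorth, hy⟩ : ∃ y ∈ E₀ᗮ, y - A y = B k := by
    have hmaps : ∀ w ∈ E₀ᗮ, (LinearMap.id - A : H →ₗ[ℂ] H) w ∈ E₀ᗮ := fun w hw =>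
      E₀ᗮ.sub_mem hw (horthA w hw)
    -- A fixed vector of `A` in `E₀ᗮ` has a constant orbit that tends to zero.
    have hinj : Function.Injective ((LinearMap.id - A : H →ₗ[ℂ] H).restrict hmaps) := by
      rw [← LinearMap.ker_eq_bot, LinearMap.ker_eq_bot']
      intro x hx
      have h1 : x.1 - A x.1 = 0 := congrArg Subtype.val hx
      have h2 : ∀ n : ℕ, (A ^ n) x.1 = x.1 := by
        intro n
        induction n with
        | zero => simp
        | succ n ih =>
          rw [pow_succ]
          change (A ^ n) (A x.1) = x.1
          rw [← sub_eq_zero.1 h1, ih]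
      have h3 := hdecay x.1 x.2
      simp only [h2] at h3
      exact Subtype.ext (tendsto_nhds_unique tendsto_const_nhds h3)
    obtain ⟨y, hy⟩ := LinearMap.injective_iff_surjective.1 hinj ⟨B k, horthB⟩
    exact ⟨y, y.2, congrArg Subtype.val hy⟩
  refine ⟨y, ?_⟩
  have hiter : ∀ t : ℕ, (fun x => A x + B k)^[t] 0 = y - (A ^ t) y := by
    intro t
    induction t with
    | zero => simp
    | succ t ih =>
      rw [Function.iterate_succ_apply', ih, pow_succ', map_sub, ← hy, Module.End.mul_apply]
      abel
  simp only [hiter]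
  simpa using (tendsto_const_nhds (x := y)).sub (hdecay y hyorth)

/-! ### Unitary matrices and their Möbius transforms. -/

namespace Matrix

section UnitaryPencil

variable {n : Type*} [Fintype n] [DecidableEq n]

open scoped Matrix.Norms.L2Operator in
theorem isUnit_one_sub_smul_of_mem_unitaryGroup {P : Matrix n n ℂ} (hP : P ∈ unitaryGroup n ℂ)
    {a : ℂ} (ha : ‖a‖ < 1) : IsUnit (1 - a • P) := by
  -- A face without boundary vertices gives matrices over an empty index type, where a unitary does
  -- not have norm one. Otherwise the Neumann series applies.
  rcases subsingleton_or_nontrivial (Matrix n n ℂ) with h | h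
  · exact isUnit_of_subsingleton _
  · have : CompleteSpace (Matrix n n ℂ) := FiniteDimensional.complete ℂ _
    apply isUnit_one_sub_of_norm_lt_one
    rw [norm_smul, CStarRing.norm_of_mem_unitary hP, mul_one]
    exact ha

/-- The Möbius transform `(ω P + d) (1 + d ω P)⁻¹` of a unitary matrix is unitary. -/
theorem moebius_mem_unitaryGroup {P : Matrix n n ℂ} (hP : P ∈ unitaryGroup n ℂ)
    {a k d ω : ℂ} (hd : star d = d) (hω : star ω * ω = 1) (ha : a = -ω * d) (hk : k = ω + a * d)
    (hu : k ≠ 0 → IsUnit (1 - a • P)) (hd0 : k = 0 → d * d = 1) :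
    k • (P * (1 - a • P)⁻¹) + d • 1 ∈ unitaryGroup n ℂ := by
  rw [mem_unitaryGroup_iff']
  by_cases hk0 : k = 0
  · simp [hk0, hd, smul_smul, hd0 hk0, star_smul]
  have hV := (Matrix.isUnit_iff_isUnit_det _).1 (hu hk0)
  have hPP : star P * P = 1 := mem_unitaryGroup_iff'.1 hP
  set V := 1 - a • P with hVdef
  have hS : k • (P * V⁻¹) + d • 1 = (ω • P + d • 1) * V⁻¹ := by
    calc k • (P * V⁻¹) + d • 1 = k • (P * V⁻¹) + d • (V * V⁻¹) := by
          rw [Matrix.mul_nonsing_inv _ hV]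
      _ = (k • P + d • V) * V⁻¹ := by rw [add_mul, smul_mul_assoc, smul_mul_assoc]
      _ = _ := by
          congr 1
          rw [hVdef, hk]
          module
  -- Since `a = -ωd` with `d` real and `ω` unimodular, both sides have the cross terms `dωP` and its
  -- adjoint, and the constant `1 + d²`.
  have hQ : star (ω • P + d • 1) * (ω • P + d • 1) = star V * V := by
    rw [hVdef, ha]
    simp only [star_add, star_sub, star_smul, star_one, star_mul', star_neg, hd, add_mul, mul_add,
      sub_mul, mul_sub, smul_mul_assoc, mul_smul_comm, mul_one, one_mul, hPP]
    match_scalars <;> first | ring1 | linear_combination (1 - d * d) * hω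
  rw [hS, star_mul, mul_assoc, ← mul_assoc (star _) _ V⁻¹, hQ, mul_assoc,
    Matrix.mul_nonsing_inv _ hV, mul_one, ← star_mul, Matrix.mul_nonsing_inv _ hV, star_one]

/-- A generalised permutation matrix with unimodular weights is unitary. -/
theorem mem_unitaryGroup_of_monomial {M : Matrix n n ℂ} {p : n → n} {w : n → ℂ}
    (hp : Function.Injective p) (hw : ∀ x, w x * star (w x) = 1)
    (hM : ∀ x y, M x y = if y = p x then w x else 0) : M ∈ unitaryGroup n ℂ := by
  rw [mem_unitaryGroup_iff]
  ext x x'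
  rw [mul_apply, Finset.sum_eq_single (p x)]
  · rw [star_apply, hM, hM, if_pos rfl, one_apply]
    by_cases h : x = x'
    · subst h
      simp only [if_true]
      exact hw x
    · rw [if_neg fun h' => h (hp h'), if_neg h, star_zero, mul_zero]
  · intro y _ hy
    rw [hM, if_neg hy, zero_mul]
  · exact fun h => absurd (Finset.mem_univ _) h

end UnitaryPencil

/-! ### Identities for the unitary coin. -/

section Coin

variable {C : Matrix (Fin 2) (Fin 2) ℂ}

theorem coin_row (hC : C ∈ unitaryGroup (Fin 2) ℂ) :
    (C 0 0 * star (C 0 0) + C 0 1 * star (C 0 1) = 1 ∧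
      C 0 0 * star (C 1 0) + C 0 1 * star (C 1 1) = 0) ∧
    C 1 0 * star (C 1 0) + C 1 1 * star (C 1 1) = 1 := by
  have h := mem_unitaryGroup_iff.1 hC
  have h00 := congrFun (congrFun h 0) 0
  have h01 := congrFun (congrFun h 0) 1
  have h11 := congrFun (congrFun h 1) 1
  simp only [mul_apply, Fin.sum_univ_two, star_apply] at h00 h01 h11
  exact ⟨⟨by simpa using h00, by simpa using h01⟩, by simpa using h11⟩

theorem coin_column (hC : C ∈ unitaryGroup (Fin 2) ℂ) :
    (star (C 0 0) * C 0 0 + star (C 1 0) * C 1 0 = 1 ∧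
      star (C 0 0) * C 0 1 + star (C 1 0) * C 1 1 = 0) ∧
    star (C 0 1) * C 0 1 + star (C 1 1) * C 1 1 = 1 := by
  have h := mem_unitaryGroup_iff'.1 hC
  have h00 := congrFun (congrFun h 0) 0
  have h01 := congrFun (congrFun h 0) 1
  have h11 := congrFun (congrFun h 1) 1
  simp only [mul_apply, Fin.sum_univ_two, star_apply] at h00 h01 h11
  exact ⟨⟨by simpa using h00, by simpa using h01⟩, by simpa using h11⟩

theorem coin_energy (hC : C ∈ unitaryGroup (Fin 2) ℂ) (p q : ℂ) :
    ‖C 0 0 * p + C 0 1 * q‖ ^ 2 + ‖C 1 0 * p + C 1 1 * q‖ ^ 2 = ‖p‖ ^ 2 + ‖q‖ ^ 2 := by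
  obtain ⟨⟨h1, h2⟩, h3⟩ := coin_column hC
  have h2' := congrArg star h2
  simp only [star_add, star_mul', star_star, star_zero] at h2'
  have key : ∀ z : ℂ, ((‖z‖ ^ 2 : ℝ) : ℂ) = star z * z := fun z => by
    rw [← Complex.normSq_eq_norm_sq, Complex.normSq_eq_conj_mul_self]
    rfl
  apply Complex.ofReal_injective
  rw [Complex.ofReal_add, Complex.ofReal_add, key, key, key, key]
  simp only [star_add, star_mul']
  linear_combination star p * p * h1 + star p * q * h2 + p * star q * h2' + star q * q * h3

theorem coin_det (hC : C ∈ unitaryGroup (Fin 2) ℂ) : star (-C.det) * -C.det = 1 := by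
  have h := (Unitary.mem_iff.1 (Matrix.det_of_mem_unitary hC)).1
  rw [star_neg, neg_mul_neg]
  exact h

/-- A unitary matrix equals its determinant times the conjugate of its cofactor matrix, so `a = det
C · conj d`. This is where the reality of `d` enters. -/
theorem coin_zero_zero (hC : C ∈ unitaryGroup (Fin 2) ℂ) (hd : star (C 1 1) = C 1 1) :
    C 0 0 = -(-C.det) * C 1 1 := by
  obtain ⟨⟨h1, h2⟩, h3⟩ := coin_row hC
  rw [det_fin_two]
  rw [hd] at h2 h3
  linear_combination (-C 0 0) * h3 + C 1 0 * h2

theorem coin_offdiag : C 0 1 * C 1 0 = -C.det + C 0 0 * C 1 1 := by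
  rw [det_fin_two]
  ring

theorem coin_norm_lt (hC : C ∈ unitaryGroup (Fin 2) ℂ) (h : C 0 1 * C 1 0 ≠ 0) :
    ‖C 0 0‖ < 1 := by
  have h1 := coin_energy hC 1 0
  simp only [mul_one, mul_zero, add_zero, norm_one, norm_zero] at h1
  have h2 : 0 < ‖C 1 0‖ := norm_pos_iff.2 (right_ne_zero_of_mul h)
  nlinarith [norm_nonneg (C 0 0)]

/-- The first row and first column have equal norm, so `|b| = |c|`. -/
theorem coin_eq_zero (hC : C ∈ unitaryGroup (Fin 2) ℂ) (h : C 0 1 * C 1 0 = 0) :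
    C 1 0 = 0 := by
  rcases mul_eq_zero.1 h with h0 | h0
  · obtain ⟨⟨h1, -⟩, -⟩ := coin_row hC
    obtain ⟨⟨h2, -⟩, -⟩ := coin_column hC
    rw [h0] at h1
    have : star (C 1 0) * C 1 0 = 0 := by linear_combination h2 - h1
    simpa using this
  · exact h0

end Coin

end Matrix

/-! ### Boundary vertices along the faces and the matrices `P_f`. -/

namespace RotationSystem

noncomputable section

variable {V : Type*} {G : SimpleGraph V} {R : RotationSystem G}

instance [Finite V] : Fintype R.Arc :=
  have := Finite.of_injective (fun e : R.Arc => e.toProd) SimpleGraph.Dart.toProd_injective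
  Fintype.ofFinite _

theorem neg_one_pow_val_add (s t : ZMod 2) :
    (-1 : ℂ) ^ (s + t).val = (-1) ^ s.val * (-1) ^ t.val := by
  rw [ZMod.val_add, ← neg_one_pow_eq_pow_mod_two, pow_add]

theorem neg_one_pow_val_sq (s : ZMod 2) : (-1 : ℂ) ^ s.val * (-1) ^ s.val = 1 := by
  rw [← mul_pow]
  simp

section Faces

variable (δ : Finset R.Arc)

theorem walkDist_spec [Finite V] {x y : R.Arc} (h : R.face x = R.face y) :
    0 < walkDist x y ∧ (R.facePerm ^ walkDist x y) y = x := by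
  have h' : R.facePerm.SameCycle y x := Equiv.Perm.SameCycle.symm (Quotient.exact h)
  obtain ⟨n, hn, -, hnx⟩ := h'.exists_pow_eq R.facePerm
  exact Nat.sInf_mem (s := {n : ℕ | 0 < n ∧ (R.facePerm ^ n) y = x}) ⟨n, hn, hnx⟩

theorem face_pow (n : ℕ) (y : R.Arc) : R.face ((R.facePerm ^ n) y) = R.face y :=
  Quotient.sound (Equiv.Perm.SameCycle.symm ⟨n, by simp⟩)

variable {δ}

/-- A walk along the face from `y` to `x` without boundary vertices in between has length
`walkDist x y`. -/
theorem walkDist_eq {x y : R.Arc} (hx : x ∈ δ) {n : ℕ} (hn : 0 < n)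
    (hnx : (R.facePerm ^ n) y = x) (hδ : ∀ k, 0 < k → k < n → (R.facePerm ^ k) y ∉ δ) :
    walkDist x y = n := by
  apply le_antisymm
  · exact Nat.sInf_le ⟨hn, hnx⟩
  · refine le_csInf ⟨n, hn, hnx⟩ ?_
    rintro m ⟨hm, hmx⟩
    by_contra hlt
    exact hδ m hm (not_le.1 hlt) (hmx ▸ hx)

/-- Walking backwards from `x`, the first boundary vertex met is the one wanted. -/
theorem exists_isNext [Finite V] {f : R.Face} (x : FaceBoundary δ f) :
    ∃ y : FaceBoundary δ f, IsNext δ x y := by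
  have hex : ∃ n : ℕ, 0 < n ∧ (R.facePerm ^ n).symm x.1 ∈ δ := by
    -- After this many steps the walk is back at `x`, so the search ends, possibly at `x` itself.
    refine ⟨orderOf R.facePerm, orderOf_pos _, ?_⟩
    rw [pow_orderOf_eq_one]
    exact x.1.2
  obtain ⟨hn, hmem⟩ := Nat.find_spec hex
  set n := Nat.find hex with hndef
  set y : R.Arc := (R.facePerm ^ n).symm x.1 with hy
  have hyx : (R.facePerm ^ n) y = x.1 := by rw [hy, Equiv.apply_symm_apply]
  have hclear : ∀ k, 0 < k → k < n → (R.facePerm ^ k) y ∉ δ := by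
    intro k hk hkn hkδ
    refine Nat.find_min hex (m := n - k) (by omega) ⟨by omega, ?_⟩
    have : x.1.1 = (R.facePerm ^ (n - k)) ((R.facePerm ^ k) y) := by
      rw [← Equiv.Perm.mul_apply, ← pow_add, Nat.sub_add_cancel hkn.le, hyx]
    rwa [this, Equiv.symm_apply_apply]
  refine ⟨⟨⟨y, hmem⟩, ?_⟩, ?_⟩
  · rw [← x.2, ← hyx, face_pow]
  · intro k hk hkn
    rw [walkDist_eq x.1.2 hn hyx hclear] at hkn
    exact hclear k hk hkn

theorem IsNext.walkDist_le [Finite V] {f : R.Face} {x x' y : FaceBoundary δ f}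
    (h : IsNext δ x' y) : walkDist (x'.1 : R.Arc) y.1 ≤ walkDist (x.1 : R.Arc) y.1 := by
  obtain ⟨hpos, hx⟩ := walkDist_spec (x.2.trans y.2.symm)
  by_contra hlt
  exact h _ hpos (not_le.1 hlt) (by rw [hx]; exact x.1.2)

theorem IsNext.left_unique [Finite V] {f : R.Face} {x x' y : FaceBoundary δ f}
    (h : IsNext δ x y) (h' : IsNext δ x' y) : x = x' := by
  have hd := le_antisymm (h.walkDist_le (x := x')) (h'.walkDist_le (x := x))
  have hx := (walkDist_spec (x.2.trans y.2.symm)).2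
  have hx' := (walkDist_spec (x'.2.trans y.2.symm)).2
  rw [hd, hx'] at hx
  exact Subtype.ext (Subtype.ext hx.symm)

/-- If the distances to `x` differ, the nearer of the two candidates lies strictly between the
farther one and `x`. -/
theorem IsNext.right_unique [Finite V] {f : R.Face} {x y y' : FaceBoundary δ f}
    (h : IsNext δ x y) (h' : IsNext δ x y') : y = y' := by
  wlog hle : walkDist (x.1 : R.Arc) y.1 ≤ walkDist (x.1 : R.Arc) y'.1 generalizing y y'
  · exact (this h' h (le_of_not_ge hle)).symm
  obtain ⟨hpos, hy⟩ := walkDist_spec (x.2.trans y.2.symm)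
  obtain ⟨-, hy'⟩ := walkDist_spec (x.2.trans y'.2.symm)
  have hyy : (R.facePerm ^ (walkDist (x.1 : R.Arc) y'.1 - walkDist (x.1 : R.Arc) y.1)) y'.1.1
      = y.1.1 := by
    apply (R.facePerm ^ walkDist (x.1 : R.Arc) y.1).injective
    rw [← Equiv.Perm.mul_apply, ← pow_add, Nat.add_sub_cancel' hle, hy, hy']
  rcases hle.eq_or_lt with heq | hlt
  · rw [heq, Nat.sub_self] at hyy
    exact Subtype.ext (Subtype.ext (by simpa using hyy.symm))
  · exact absurd (hyy ▸ y.1.2) (h' _ (by omega) (by omega))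

/-- The last boundary vertex met before `x` on the facial walk. -/
def previous [Finite V] {f : R.Face} (x : FaceBoundary δ f) : FaceBoundary δ f :=
  (exists_isNext x).choose

theorem isNext_iff [Finite V] {f : R.Face} {x y : FaceBoundary δ f} :
    IsNext δ x y ↔ y = previous x := by
  have h := (exists_isNext x).choose_spec
  exact ⟨fun h' => h'.right_unique h, fun h' => h' ▸ h⟩

theorem previous_injective [Finite V] {f : R.Face} :
    Function.Injective (previous : FaceBoundary δ f → FaceBoundary δ f) := fun _ _ h =>
  IsNext.left_unique (isNext_iff.2 rfl) (isNext_iff.2 h)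

/-- The weight of the walk from the preceding boundary vertex to `x`. -/
def previousWeight [Finite V] (ω : ℂ) {f : R.Face} (x : FaceBoundary δ f) : ℂ :=
  (-1) ^ (walkTwist (x.1 : R.Arc) (previous x).1).val * ω ^ walkDist (x.1 : R.Arc) (previous x).1

theorem faceMatrix_apply [Finite V] (ω : ℂ) {f : R.Face} (x y : FaceBoundary δ f) :
    faceMatrix δ f ω x y = if y = previous x then previousWeight ω x else 0 := by
  simp only [faceMatrix, Matrix.of_apply, isNext_iff]
  split_ifs with h
  · rw [h, previousWeight]
  · rfl

theorem faceMatrix_mem_unitaryGroup [Finite V] {ω : ℂ} (hω : star ω * ω = 1) (f : R.Face) :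
    faceMatrix δ f ω ∈ Matrix.unitaryGroup (FaceBoundary δ f) ℂ := by
  refine Matrix.mem_unitaryGroup_of_monomial previous_injective (fun x => ?_)
    (faceMatrix_apply ω)
  rw [previousWeight, star_mul', star_pow, star_pow, star_neg, star_one, mul_mul_mul_comm,
    neg_one_pow_val_sq, ← mul_pow, mul_comm, mul_one, mul_comm ω, hω, one_pow]

/-- Every island arc carries a boundary vertex, so consecutive ones are one bridge apart. -/
theorem faceMatrix_eq_smul_hedgehogMatrix [Finite V] (hδ : ∀ e : R.Arc, e ∈ δ) (f : R.Face) (ω : ℂ) :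
    faceMatrix δ f ω = ω • hedgehogMatrix δ f := by
  ext x y
  simp only [faceMatrix, hedgehogMatrix, Matrix.of_apply, Matrix.smul_apply, smul_eq_mul]
  by_cases hxy : (x.1 : R.Arc) = R.facePerm y.1
  · have hdist : walkDist (x.1 : R.Arc) y.1 = 1 :=
      walkDist_eq x.1.2 one_pos (by simpa using hxy.symm) (by omega)
    have hnext : IsNext δ x y := fun n hn hn1 => by omega
    rw [if_pos hnext, if_pos hxy, walkTwist, hdist, Finset.sum_range_one, zero_add, pow_one,
      pow_one, ← hxy, mul_comm]
  · have hnext : ¬ IsNext δ x y := fun h => by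
      obtain ⟨hpos, hx⟩ := walkDist_spec (x.2.trans y.2.symm)
      rcases (Nat.succ_le_iff.2 hpos).eq_or_lt with h1 | h1
      · rw [← h1] at hx
        exact hxy (by simpa using hx.symm)
      · exact h 1 one_pos h1 (hδ _)
    rw [if_neg hnext, if_neg hxy, mul_zero]

theorem faceSum_mulVec [Finite V] (S : (f : R.Face) → Matrix (FaceBoundary δ f) (FaceBoundary δ f) ℂ)
    (α : δ → ℂ) (x : δ) :
    (faceSum δ S).mulVec α x =
      (S (R.face x)).mulVec (fun y => α y.1) ⟨x, rfl⟩ := by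
  let e := Equiv.sigmaFiberEquiv fun x : δ => R.face x
  have : Finite R.Face := Quotient.finite _
  have : Fintype R.Face := Fintype.ofFinite _
  rw [Matrix.mulVec, dotProduct, ← e.sum_comp, Fintype.sum_sigma,
    Finset.sum_eq_single (R.face x)]
  · refine Finset.sum_congr rfl fun y _ => ?_
    have he : e ⟨R.face x, y⟩ = y.1 := rfl
    have hx : e.symm x = ⟨R.face x, x, rfl⟩ := rfl
    rw [he]
    congr 1
    rw [faceSum, Matrix.reindex_apply, Matrix.submatrix_apply]
    change Matrix.blockDiagonal' S (e.symm x) (e.symm (e ⟨R.face x, y⟩)) = _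
    rw [Equiv.symm_apply_apply, hx, Matrix.blockDiagonal'_apply_eq]
  · intro f _ hf
    refine Finset.sum_eq_zero fun y _ => ?_
    have hx : e.symm x = ⟨R.face x, x, rfl⟩ := rfl
    rw [faceSum, Matrix.reindex_apply, Matrix.submatrix_apply]
    change Matrix.blockDiagonal' S (e.symm x) (e.symm (e ⟨f, y⟩)) * _ = _
    rw [Equiv.symm_apply_apply, hx, Matrix.blockDiagonal'_apply_ne _ _ _ (Ne.symm hf), zero_mul]
  · exact fun h => absurd (Finset.mem_univ _) h

end Faces

end

end RotationSystem

/-! ### Energy balance and existence of the stationary state. -/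

namespace RotationSystem

noncomputable section

variable {V : Type*} {G : SimpleGraph V} {R : RotationSystem G} {δ : Finset R.Arc}
  {C : Matrix (Fin 2) (Fin 2) ℂ}

section Dynamics

theorem evolve_islandStart (Ψ : R.TailedArc δ → ℂ) (e : R.Arc) :
    evolve C δ Ψ (islandStart δ e) = toIsland C δ Ψ e := by
  unfold islandStart
  split_ifs <;> rfl

variable (C) in
theorem continuous_evolve : Continuous (evolve C δ) := by
  refine continuous_pi fun ξ => ?_
  rcases ξ with _ | _ | _ | _ | _ | ⟨_, _ | _⟩ <;> simp only [evolve, toIsland] <;> fun_prop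

theorem IsStationaryState.evolve_eq {α : δ → ℂ} {Ψ : R.TailedArc δ → ℂ}
    (h : IsStationaryState C δ α Ψ) : evolve C δ Ψ = Ψ := by
  have h1 := tendsto_pi_nhds.2 h
  have h2 := ((continuous_evolve C).tendsto Ψ).comp h1
  have h3 := (Filter.tendsto_add_atTop_iff_nat 1).2 h1
  refine tendsto_nhds_unique h2 (h3.congr fun t => ?_)
  rw [Function.iterate_succ_apply']
  rfl

theorem iterate_evolve_tailIn (α : δ → ℂ) (t : ℕ) (x : δ) (j : ℕ) :
    (evolve C δ)^[t] (initialState δ α) (.tailIn x j) = α x := by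
  induction t generalizing j with
  | zero => rfl
  | succ t ih =>
    rw [Function.iterate_succ_apply']
    exact ih (j + 1)

theorem IsStationaryState.tailIn_eq {α : δ → ℂ} {Ψ : R.TailedArc δ → ℂ}
    (h : IsStationaryState C δ α Ψ) (x : δ) (j : ℕ) : Ψ (.tailIn x j) = α x := by
  have := h (.tailIn x j)
  simp only [iterate_evolve_tailIn] at this
  exact tendsto_nhds_unique this tendsto_const_nhds

theorem sum_boundary_eq [Finite V] (g : δ → ℝ) :
    ∑ x, g x = ∑ e : R.Arc, if h : e ∈ δ then g ⟨e, h⟩ else 0 := by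
  rw [← Finset.sum_subset (Finset.subset_univ δ) fun e _ he => dif_neg he,
    ← Finset.sum_coe_sort δ]
  exact Finset.sum_congr rfl fun x _ => by rw [dif_pos x.2]

/-- Start and end coincide on an undivided island arc; on a divided one they are the two quays,
which the extra sums exchange. -/
theorem energy_islands [Finite V] (Ψ : R.TailedArc δ → ℂ) :
    ∑ e, ‖Ψ (islandEnd δ e)‖ ^ 2 + ∑ x, ‖Ψ (.quayIn x)‖ ^ 2 =
      ∑ e, ‖Ψ (islandStart δ e)‖ ^ 2 + ∑ x, ‖Ψ (.quayOut x)‖ ^ 2 := by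
  rw [sum_boundary_eq, sum_boundary_eq, ← Finset.sum_add_distrib, ← Finset.sum_add_distrib]
  refine Finset.sum_congr rfl fun e _ => ?_
  unfold islandEnd islandStart
  split_ifs
  · exact add_comm _ _
  · rfl

/-- The energy of the interior changes in a step of the walk by the inflow minus the outflow. -/
theorem energy_evolve [Finite V] (hC : C ∈ Matrix.unitaryGroup (Fin 2) ℂ)
    (Ψ : R.TailedArc δ → ℂ) :
    (∑ e, ‖evolve C δ Ψ (islandStart δ e)‖ ^ 2 +
      (∑ x, ‖evolve C δ Ψ (.quayOut x)‖ ^ 2 + ∑ e, ‖evolve C δ Ψ (.bridge e)‖ ^ 2)) +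
        ∑ x, ‖evolve C δ Ψ (.tailOut x 0)‖ ^ 2 =
    (∑ e, ‖Ψ (islandStart δ e)‖ ^ 2 +
      (∑ x, ‖Ψ (.quayOut x)‖ ^ 2 + ∑ e, ‖Ψ (.bridge e)‖ ^ 2)) +
        ∑ x, ‖Ψ (.tailIn x 0)‖ ^ 2 := by
  have hvertex : ∑ e, ‖evolve C δ Ψ (islandStart δ e)‖ ^ 2 +
      ∑ e, ‖evolve C δ Ψ (.bridge e)‖ ^ 2 =
      ∑ e, ‖Ψ (islandEnd δ e)‖ ^ 2 + ∑ e, ‖Ψ (.bridge e)‖ ^ 2 := by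
    -- Incoming arcs are reindexed by the vertex they enter, so that the balance can be checked coin
    -- by coin.
    rw [← R.coverRot.symm.sum_comp fun e => ‖Ψ (islandEnd δ e)‖ ^ 2,
      ← Equiv.sum_comp (SimpleGraph.Dart.symm_involutive (G := R.cover)).toPerm
        fun e : R.Arc => ‖Ψ (.bridge e)‖ ^ 2, ← Finset.sum_add_distrib, ← Finset.sum_add_distrib]
    refine Finset.sum_congr rfl fun e _ => ?_
    rw [evolve_islandStart, Function.Involutive.coe_toPerm,
      ← Matrix.coin_energy hC (Ψ (islandEnd δ (R.coverRot.symm e)))]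
    simp [evolve, toIsland]
  have hboundary : ∑ x, ‖evolve C δ Ψ (.quayOut x)‖ ^ 2 +
      ∑ x, ‖evolve C δ Ψ (.tailOut x 0)‖ ^ 2 =
      ∑ x, ‖Ψ (.quayIn x)‖ ^ 2 + ∑ x, ‖Ψ (.tailIn x 0)‖ ^ 2 := by
    rw [← Finset.sum_add_distrib, ← Finset.sum_add_distrib]
    exact Finset.sum_congr rfl fun x _ => Matrix.coin_energy hC _ _
  have hislands := energy_islands Ψ
  linarith

variable (δ) in
/-- The Hilbert space of states supported on the interior: one coordinate for the initial part of
each island arc, one for the second part of each divided island arc, one for each bridge. -/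
abbrev InteriorSpace [Finite V] : Type _ := EuclideanSpace ℂ (R.Arc ⊕ δ ⊕ R.Arc)

variable (δ) in
/-- The restriction of a state to the interior. -/
def interior [Finite V] : (R.TailedArc δ → ℂ) →ₗ[ℂ] InteriorSpace δ where
  toFun Ψ := WithLp.toLp 2 (Sum.elim (fun e => Ψ (islandStart δ e))
    (Sum.elim (fun x => Ψ (.quayOut x)) fun e => Ψ (.bridge e)))
  map_add' Ψ Φ := by ext (_ | _ | _) <;> rfl
  map_smul' c Ψ := by ext (_ | _ | _) <;> rfl

variable (δ) in
/-- The state with given interior part and constant inflow. -/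
def ofInterior [Finite V] :
    InteriorSpace δ × EuclideanSpace ℂ δ →ₗ[ℂ] (R.TailedArc δ → ℂ) where
  toFun v ξ := match ξ with
    | .island e _ => v.1 (.inl e)
    | .quayIn x => v.1 (.inl x)
    | .quayOut x => v.1 (.inr (.inl x))
    | .bridge e => v.1 (.inr (.inr e))
    | .tailIn x _ => v.2 x
    | .tailOut _ _ => 0
  map_add' v w := by
    funext ξ
    cases ξ <;> simp
  map_smul' c v := by
    funext ξ
    cases ξ <;> simp

variable (C δ) in
/-- The time evolution operator as a linear map. -/
def evolveLinear : (R.TailedArc δ → ℂ) →ₗ[ℂ] (R.TailedArc δ → ℂ) where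
  toFun := evolve C δ
  map_add' Ψ Φ := by
    funext ξ
    rcases ξ with _ | _ | _ | _ | _ | ⟨_, _ | _⟩ <;> simp only [evolve, toIsland, Pi.add_apply] <;>
      ring
  map_smul' c Ψ := by
    funext ξ
    rcases ξ with _ | _ | _ | _ | _ | ⟨_, _ | _⟩ <;>
      simp only [evolve, toIsland, Pi.smul_apply, smul_eq_mul, RingHom.id_apply] <;> ring

theorem interior_ofInterior [Finite V] (v : InteriorSpace δ × EuclideanSpace ℂ δ) :
    interior δ (ofInterior δ v) = v.1 := by
  ext (e | _ | _)
  · change ofInterior δ v (islandStart δ e) = _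
    unfold islandStart
    split_ifs <;> rfl
  · rfl
  · rfl

/-- The interior together with the innermost inward tail arcs determines the next interior, so
outgoing tails never act back. This turns the infinite walk into a finite-dimensional driven system.
-/
theorem interior_evolve_congr [Finite V] {Ψ Φ : R.TailedArc δ → ℂ}
    (h : interior δ Ψ = interior δ Φ) (h' : ∀ x, Ψ (.tailIn x 0) = Φ (.tailIn x 0)) :
    interior δ (evolve C δ Ψ) = interior δ (evolve C δ Φ) := by
  have hstart : ∀ e, Ψ (islandStart δ e) = Φ (islandStart δ e) := fun e =>
    congrArg (fun v => v.ofLp (.inl e)) h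
  have hquay : ∀ x, Ψ (.quayOut x) = Φ (.quayOut x) := fun x =>
    congrArg (fun v => v.ofLp (.inr (.inl x))) h
  have hbridge : ∀ e, Ψ (.bridge e) = Φ (.bridge e) := fun e =>
    congrArg (fun v => v.ofLp (.inr (.inr e))) h
  have hquayIn : ∀ x : δ, Ψ (.quayIn x) = Φ (.quayIn x) := fun x => by
    simpa [islandStart] using hstart x
  have hend : ∀ e, Ψ (islandEnd δ e) = Φ (islandEnd δ e) := fun e => by
    by_cases he : e ∈ δ
    · simpa [islandEnd, he] using hquay ⟨e, he⟩
    · simpa [islandEnd, islandStart, he] using hstart e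
  ext (e | x | e)
  · change evolve C δ Ψ (islandStart δ e) = evolve C δ Φ (islandStart δ e)
    rw [evolve_islandStart, evolve_islandStart, toIsland, toIsland, hend, hbridge]
  · change evolve C δ Ψ (.quayOut x) = evolve C δ Φ (.quayOut x)
    simp only [evolve, hquayIn, h']
  · change evolve C δ Ψ (.bridge e) = evolve C δ Φ (.bridge e)
    simp only [evolve, hend, hbridge]

theorem norm_interior_sq [Finite V] (Ψ : R.TailedArc δ → ℂ) :
    ‖interior δ Ψ‖ ^ 2 = ∑ e, ‖Ψ (islandStart δ e)‖ ^ 2 +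
      (∑ x, ‖Ψ (.quayOut x)‖ ^ 2 + ∑ e, ‖Ψ (.bridge e)‖ ^ 2) := by
  rw [EuclideanSpace.norm_sq_eq, Fintype.sum_sum_type, Fintype.sum_sum_type]
  rfl

theorem exists_tendsto_interior [Finite V] (hC : C ∈ Matrix.unitaryGroup (Fin 2) ℂ)
    (α : δ → ℂ) : ∃ y, Filter.Tendsto
      (fun t : ℕ => interior δ ((evolve C δ)^[t] (initialState δ α))) Filter.atTop (𝓝 y) := by
  let outflow : (R.TailedArc δ → ℂ) →ₗ[ℂ] EuclideanSpace ℂ δ :=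
    { toFun := fun Ψ => WithLp.toLp 2 fun x => Ψ (.tailOut x 0)
      map_add' := fun _ _ => rfl
      map_smul' := fun _ _ => rfl }
  let U := evolveLinear δ C ∘ₗ ofInterior δ
  let A := (interior δ ∘ₗ U) ∘ₗ LinearMap.inl ℂ _ _
  let B := (interior δ ∘ₗ U) ∘ₗ LinearMap.inr ℂ _ _
  have hAB : ∀ v k, A v + B k = interior δ (evolve C δ (ofInterior δ (v, k))) := fun v k => by
    change (interior δ ∘ₗ U) (v, 0) + (interior δ ∘ₗ U) (0, k) = (interior δ ∘ₗ U) (v, k)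
    rw [← map_add, Prod.mk_add_mk, add_zero, zero_add]
  have hDE : ∀ v k, (outflow ∘ₗ U) (v, 0) + (outflow ∘ₗ U) (0, k) =
      outflow (evolve C δ (ofInterior δ (v, k))) := fun v k => by
    rw [← map_add, Prod.mk_add_mk, add_zero, zero_add]
    rfl
  obtain ⟨y, hy⟩ := exists_tendsto_iterate_of_energy A B ((outflow ∘ₗ U) ∘ₗ LinearMap.inl ℂ _ _)
    -- The energy hypothesis is the balance of one step started from interior `v` and inflow `k`.
    ((outflow ∘ₗ U) ∘ₗ LinearMap.inr ℂ _ _) (fun v k => by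
      rw [hAB]
      change _ + ‖(outflow ∘ₗ U) (v, 0) + (outflow ∘ₗ U) (0, k)‖ ^ 2 = _
      have h1 := energy_evolve hC (ofInterior δ (v, k))
      rw [← norm_interior_sq, ← norm_interior_sq, interior_ofInterior] at h1
      rw [hDE, EuclideanSpace.norm_sq_eq (outflow _), EuclideanSpace.norm_sq_eq k]
      exact h1) (WithLp.toLp 2 α)
  refine ⟨y, hy.congr fun t => ?_⟩
  induction t with
  | zero =>
    ext (e | _ | _)
    · change 0 = initialState δ α (islandStart δ e)
      unfold islandStart
      split_ifs <;> rfl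
    · rfl
    · rfl
  | succ t ih =>
    rw [Function.iterate_succ_apply', Function.iterate_succ_apply', ih, hAB]
    refine interior_evolve_congr (interior_ofInterior _) fun x => ?_
    rw [iterate_evolve_tailIn]
    rfl

theorem exists_isStationaryState [Finite V] (hC : C ∈ Matrix.unitaryGroup (Fin 2) ℂ)
    (α : δ → ℂ) : ∃ Ψ, IsStationaryState C δ α Ψ := by
  obtain ⟨y, hy⟩ := exists_tendsto_interior hC α
  have hcoord : ∀ i, Filter.Tendsto
      (fun t : ℕ => interior δ ((evolve C δ)^[t] (initialState δ α)) i) Filter.atTop (𝓝 (y i)) :=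
    fun i => ((EuclideanSpace.proj (𝕜 := ℂ) i).continuous.tendsto y).comp hy
  have hquayIn : ∀ x : δ, Filter.Tendsto
      (fun t : ℕ => (evolve C δ)^[t] (initialState δ α) (.quayIn x)) Filter.atTop
        (𝓝 (y (.inl x))) := fun x => by
    refine (hcoord (.inl x)).congr fun t => ?_
    change (evolve C δ)^[t] (initialState δ α) (islandStart δ x) = _
    rw [islandStart, dif_pos x.2]
  have hall : ∀ ξ, ∃ z, Filter.Tendsto
      (fun t : ℕ => (evolve C δ)^[t] (initialState δ α) ξ) Filter.atTop (𝓝 z) := by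
    rintro (⟨e, he⟩ | x | x | e | ⟨x, j⟩ | ⟨x, j⟩)
    · refine ⟨_, (hcoord (.inl e)).congr fun t => ?_⟩
      change (evolve C δ)^[t] (initialState δ α) (islandStart δ e) = _
      rw [islandStart, dif_neg he]
    · exact ⟨_, hquayIn x⟩
    · exact ⟨_, hcoord (.inr (.inl x))⟩
    · exact ⟨_, hcoord (.inr (.inr e))⟩
    · refine ⟨α x, ?_⟩
      simp only [iterate_evolve_tailIn]
      exact tendsto_const_nhds
    -- An outward tail arc repeats its predecessor one time step later, the first one being fed by
    -- the convergent quay and the constant inflow.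
    · induction j with
      | zero =>
        refine ⟨_, (Filter.tendsto_add_atTop_iff_nat 1).1
          ((((hquayIn x).const_mul (C 1 0)).add_const (C 1 1 * α x)).congr fun t => ?_)⟩
        rw [Function.iterate_succ_apply', ← iterate_evolve_tailIn (C := C) α t x 0]
        rfl
      | succ j ih =>
        obtain ⟨z, hz⟩ := ih
        refine ⟨z, (Filter.tendsto_add_atTop_iff_nat 1).1 (hz.congr fun t => ?_)⟩
        rw [Function.iterate_succ_apply']
        rfl
  choose Ψ hΨ using hall
  exact ⟨Ψ, hΨ⟩

end Dynamics

end

end RotationSystem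

/-! ### Transmission along the faces and the scattering matrix. -/

namespace RotationSystem

noncomputable section

variable {V : Type*} {G : SimpleGraph V} {R : RotationSystem G} {δ : Finset R.Arc}
  {C : Matrix (Fin 2) (Fin 2) ℂ}

section Scattering

theorem coverTwist_symm (e : R.Arc) : R.coverTwist e.symm = R.coverTwist e :=
  R.twist_symm (R.proj e)

/-- In a stationary state, a bridge acts like a perfectly transmitting crossing between consecutive
island arcs of a facial walk. -/
theorem islandStart_facePerm {Ψ : R.TailedArc δ → ℂ} (hΨ : evolve C δ Ψ = Ψ) {ω : ℂ}
    (ha : C 0 0 = -ω * C 1 1) (hk : C 0 1 * C 1 0 = ω + C 0 0 * C 1 1)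
    (hbc : C 0 1 * C 1 0 ≠ 0) (e : R.Arc) :
    Ψ (islandStart δ (R.facePerm e)) =
      (-1) ^ (R.coverTwist (R.facePerm e)).val * ω * Ψ (islandEnd δ e) := by
  have hsymm : (R.facePerm e).symm = R.coverRot e := SimpleGraph.Dart.symm_symm _
  have hr : Ψ (islandStart δ (R.facePerm e)) = C 0 0 * Ψ (islandEnd δ (R.coverRot.symm
      (R.facePerm e))) + C 0 1 * Ψ (.bridge (R.coverRot e)) := by
    conv_lhs => rw [← hΨ]
    rw [evolve_islandStart, toIsland, hsymm]
  have hq : Ψ (.bridge (R.coverRot e)) = (-1) ^ (R.coverTwist (R.facePerm e)).val *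
      (C 1 0 * Ψ (islandEnd δ e) + C 1 1 * Ψ (.bridge (R.facePerm e))) := by
    conv_lhs => rw [← hΨ]
    rw [← coverTwist_symm (R.facePerm e), hsymm]
    simp only [evolve, Equiv.symm_apply_apply]
    rfl
  have hq' : Ψ (.bridge (R.facePerm e)) = (-1) ^ (R.coverTwist (R.facePerm e)).val *
      (C 1 0 * Ψ (islandEnd δ (R.coverRot.symm (R.facePerm e))) +
        C 1 1 * Ψ (.bridge (R.coverRot e))) := by
    conv_lhs => rw [← hΨ]
    simp only [evolve, hsymm]
  have hs := neg_one_pow_val_sq (R.coverTwist (R.facePerm e))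
  generalize (-1 : ℂ) ^ (R.coverTwist (R.facePerm e)).val = s at *
  generalize Ψ (.bridge (R.facePerm e)) = q' at *
  generalize Ψ (.bridge (R.coverRot e)) = q at *
  generalize Ψ (islandEnd δ (R.coverRot.symm (R.facePerm e))) = p at *
  rw [hr]
  -- Substituting `q'` into the equation for `q` gives `(1 - d²) q = s c Ψ(islandEnd e) + d c p`;
  -- the sign disappears from the round trip. Multiplied by `ω`, the left side becomes `bc q`, and
  -- the terms in `p` cancel by `a = -ωd`.
  have hqq : q - s * C 1 0 * Ψ (islandEnd δ e) - C 1 1 * C 1 0 * p - C 1 1 ^ 2 * q = 0 := by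
    linear_combination hq + s * C 1 1 * hq' + (C 1 1 * C 1 0 * p + C 1 1 ^ 2 * q) * hs
  apply mul_left_cancel₀ hbc
  linear_combination C 0 1 * ω * hqq + C 0 1 * q * hk + (C 0 1 * q * C 1 1) * ha
    + C 0 1 * C 1 0 * p * ha

theorem islandStart_facePerm_pow {Ψ : R.TailedArc δ → ℂ} (hΨ : evolve C δ Ψ = Ψ) {ω : ℂ}
    (ha : C 0 0 = -ω * C 1 1) (hk : C 0 1 * C 1 0 = ω + C 0 0 * C 1 1)
    (hbc : C 0 1 * C 1 0 ≠ 0) (e : R.Arc) (n : ℕ)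
    (hδ : ∀ k, 0 < k → k < n + 1 → (R.facePerm ^ k) e ∉ δ) :
    Ψ (islandStart δ ((R.facePerm ^ (n + 1)) e)) =
      (-1) ^ (∑ i ∈ Finset.range (n + 1), R.coverTwist ((R.facePerm ^ (i + 1)) e)).val *
        ω ^ (n + 1) * Ψ (islandEnd δ e) := by
  induction n with
  | zero => simpa using islandStart_facePerm hΨ ha hk hbc e
  | succ n ih =>
    -- An intermediate island arc is undivided, so what enters it is what leaves it.
    have hend : islandEnd δ ((R.facePerm ^ (n + 1)) e) =
        islandStart δ ((R.facePerm ^ (n + 1)) e) := by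
      have := hδ (n + 1) n.succ_pos (n + 1).lt_succ_self
      rw [islandEnd, islandStart, dif_neg this, dif_neg this]
    rw [Finset.sum_range_succ, neg_one_pow_val_add, pow_succ' R.facePerm, Equiv.Perm.mul_apply,
      islandStart_facePerm hΨ ha hk hbc, hend,
      ih fun k hk hkn => hδ k hk (hkn.trans (n + 1).lt_succ_self), pow_succ ω (n + 1)]
    ring

theorem quayIn_eq_faceMatrix_mulVec [Finite V] {Ψ : R.TailedArc δ → ℂ}
    (hΨ : evolve C δ Ψ = Ψ) {ω : ℂ}
    (ha : C 0 0 = -ω * C 1 1) (hk : C 0 1 * C 1 0 = ω + C 0 0 * C 1 1)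
    (hbc : C 0 1 * C 1 0 ≠ 0) (f : R.Face) :
    (fun x : FaceBoundary δ f => Ψ (.quayIn x.1)) =
      (faceMatrix δ f ω).mulVec fun x => Ψ (.quayOut x.1) := by
  funext x
  have hnext : IsNext δ x (previous x) := isNext_iff.2 rfl
  have hrow : (faceMatrix δ f ω).mulVec (fun x => Ψ (.quayOut x.1)) x =
      previousWeight ω x * Ψ (.quayOut (previous x).1) := by
    simp [Matrix.mulVec, dotProduct, faceMatrix_apply]
  obtain ⟨hpos, hx⟩ := walkDist_spec (x.2.trans (previous x).2.symm)
  rw [hrow, previousWeight, walkTwist]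
  unfold IsNext at hnext
  obtain ⟨n, hn⟩ := Nat.exists_eq_add_one.2 hpos
  rw [hn] at hx hnext ⊢
  have := islandStart_facePerm_pow hΨ ha hk hbc ((previous x).1 : R.Arc) n hnext
  rw [hx] at this
  simpa [islandStart, islandEnd] using this

/-- The scattering matrix of a face. -/
def faceScattering (C : Matrix (Fin 2) (Fin 2) ℂ) (δ : Finset R.Arc) [Finite V] (ω : ℂ)
    (f : R.Face) : Matrix (FaceBoundary δ f) (FaceBoundary δ f) ℂ :=
  (C 0 1 * C 1 0) • (faceMatrix δ f ω * (1 - C 0 0 • faceMatrix δ f ω)⁻¹) + C 1 1 • 1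

theorem IsStationaryState.tailOut_eq [Finite V] (hC : C ∈ Matrix.unitaryGroup (Fin 2) ℂ)
    (hd : star (C 1 1) = C 1 1) {α : δ → ℂ} {Ψ : R.TailedArc δ → ℂ}
    (h : IsStationaryState C δ α Ψ) :
    (fun x : δ => Ψ (.tailOut x 0)) =
      (faceSum δ (faceScattering C δ (-C.det))).mulVec fun x : δ => Ψ (.tailIn x 0) := by
  have hΨ := h.evolve_eq
  have hout : ∀ x : δ, Ψ (.tailOut x 0) =
      C 1 0 * Ψ (.quayIn x) + C 1 1 * Ψ (.tailIn x 0) := fun x => by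
    conv_lhs => rw [← hΨ]
    rfl
  have hquay : ∀ x : δ, Ψ (.quayOut x) =
      C 0 0 * Ψ (.quayIn x) + C 0 1 * Ψ (.tailIn x 0) := fun x => by
    conv_lhs => rw [← hΨ]
    rfl
  funext x
  rw [faceSum_mulVec, faceScattering]
  by_cases hbc : C 0 1 * C 1 0 = 0
  -- Here `c = 0`: nothing from the interior reaches the tails.
  · rw [hbc, zero_smul, zero_add, Matrix.smul_mulVec, Matrix.one_mulVec, hout,
      Matrix.coin_eq_zero hC hbc, zero_mul, zero_add]
    rfl
  · set f := R.face x
    set P := faceMatrix δ f (-C.det)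
    set p : FaceBoundary δ f → ℂ := fun y => Ψ (.quayIn y.1)
    set q : FaceBoundary δ f → ℂ := fun y => Ψ (.quayOut y.1)
    set u : FaceBoundary δ f → ℂ := fun y => Ψ (.tailIn y.1 0)
    have hpq : p = P.mulVec q := quayIn_eq_faceMatrix_mulVec hΨ (Matrix.coin_zero_zero hC hd)
      Matrix.coin_offdiag hbc f
    have hq : q = C 0 0 • p + C 0 1 • u := funext fun y => hquay y.1
    have hunit := (Matrix.isUnit_iff_isUnit_det _).1 <|
      Matrix.isUnit_one_sub_smul_of_mem_unitaryGroup
        (faceMatrix_mem_unitaryGroup (δ := δ) (Matrix.coin_det hC) f) (Matrix.coin_norm_lt hC hbc)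
    -- Inserting `p = P q` into `q = a p + b u` leaves a linear system for `q` alone.
    have hVq : (1 - C 0 0 • P).mulVec q = C 0 1 • u := by
      rw [Matrix.sub_mulVec, Matrix.one_mulVec, Matrix.smul_mulVec, ← hpq, sub_eq_iff_eq_add',
        ← hq]
    have hq' : q = C 0 1 • (1 - C 0 0 • P)⁻¹.mulVec u := by
      rw [← Matrix.mulVec_smul, ← hVq, Matrix.mulVec_mulVec, Matrix.nonsing_inv_mul _ hunit,
        Matrix.one_mulVec]
    have hp : p = C 0 1 • (P * (1 - C 0 0 • P)⁻¹).mulVec u := by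
      rw [hpq, hq', Matrix.mulVec_smul, Matrix.mulVec_mulVec]
    have hpx := congrFun hp ⟨x, rfl⟩
    rw [hout, Matrix.add_mulVec, Matrix.smul_mulVec, Matrix.smul_mulVec, Matrix.one_mulVec]
    change Ψ (.quayIn x) = C 0 1 * _ at hpx
    rw [hpx]
    simp only [Pi.add_apply, Pi.smul_apply, smul_eq_mul, u]
    ring

theorem isScatteringMatrix_iff [Finite V] (hC : C ∈ Matrix.unitaryGroup (Fin 2) ℂ)
    (hd : star (C 1 1) = C 1 1) (S : Matrix δ δ ℂ) :
    IsScatteringMatrix C δ S ↔ S = faceSum δ (faceScattering C δ (-C.det)) := by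
  constructor
  · intro hS
    apply Matrix.mulVec_injective
    funext α
    obtain ⟨Ψ, hΨ, hout⟩ := hS α
    -- The inflow stays constant in time, so every vector occurs as `α_in`, and this determines the
    -- matrix.
    have hin : (fun x : δ => Ψ (.tailIn x 0)) = α := funext fun x => hΨ.tailIn_eq x 0
    rw [hΨ.tailOut_eq hC hd, hin] at hout
    exact hout.symm
  · rintro rfl α
    obtain ⟨Ψ, hΨ⟩ := exists_isStationaryState hC α
    exact ⟨Ψ, hΨ, hΨ.tailOut_eq hC hd⟩

end Scattering

end

end RotationSystem

/-! ### Assembly of the theorem and the hedgehog case. -/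

theorem theorem6 {V : Type*} [Finite V] {G : SimpleGraph V} (R : RotationSystem G)
    (δ : Finset R.Arc) (C : Matrix (Fin 2) (Fin 2) ℂ) (hC : C ∈ Matrix.unitaryGroup (Fin 2) ℂ)
    (hd : (C 1 1).im = 0) (ω : ℂ) (hω : ω = -C.det) :
    (∀ f : R.Face,
      RotationSystem.faceMatrix δ f ω ∈ Matrix.unitaryGroup _ ℂ ∧
      (C 0 1 * C 1 0 ≠ 0 → IsUnit (1 - C 0 0 • RotationSystem.faceMatrix δ f ω)) ∧
      (C 0 1 * C 1 0) • (RotationSystem.faceMatrix δ f ω *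
        (1 - C 0 0 • RotationSystem.faceMatrix δ f ω)⁻¹) + C 1 1 • 1 ∈
          Matrix.unitaryGroup _ ℂ) ∧
    (∀ S : Matrix δ δ ℂ, RotationSystem.IsScatteringMatrix C δ S ↔
      S = RotationSystem.faceSum δ fun f =>
        (C 0 1 * C 1 0) • (RotationSystem.faceMatrix δ f ω *
          (1 - C 0 0 • RotationSystem.faceMatrix δ f ω)⁻¹) + C 1 1 • 1) ∧
    ((∀ e : R.Arc, e ∈ δ) →
      (∀ f : R.Face,
        RotationSystem.hedgehogMatrix δ f ∈ Matrix.unitaryGroup _ ℂ ∧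
        (C 0 1 * C 1 0 ≠ 0 →
          IsUnit (1 - (C 0 0 * ω) • RotationSystem.hedgehogMatrix δ f)) ∧
        (C 0 1 * C 1 0 * ω) • (RotationSystem.hedgehogMatrix δ f *
          (1 - (C 0 0 * ω) • RotationSystem.hedgehogMatrix δ f)⁻¹) + C 1 1 • 1 ∈
            Matrix.unitaryGroup _ ℂ) ∧
      (∀ S : Matrix δ δ ℂ, RotationSystem.IsScatteringMatrix C δ S ↔
        S = RotationSystem.faceSum δ fun f =>
          (C 0 1 * C 1 0 * ω) • (RotationSystem.hedgehogMatrix δ f *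
            (1 - (C 0 0 * ω) • RotationSystem.hedgehogMatrix δ f)⁻¹) + C 1 1 • 1)) := by
  subst hω
  have hd' : star (C 1 1) = C 1 1 := Complex.conj_eq_iff_im.2 hd
  have hω := Matrix.coin_det hC
  have ha := Matrix.coin_zero_zero hC hd'
  have hk : C 0 1 * C 1 0 = -C.det + C 0 0 * C 1 1 := Matrix.coin_offdiag
  have hd0 : C 0 1 * C 1 0 = 0 → C 1 1 * C 1 1 = 1 := fun h => by
    have h1 := (Matrix.coin_row hC).2
    rwa [hd', Matrix.coin_eq_zero hC h, zero_mul, zero_add] at h1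
  have hface : ∀ f : R.Face,
      RotationSystem.faceMatrix δ f (-C.det) ∈ Matrix.unitaryGroup _ ℂ ∧
      (C 0 1 * C 1 0 ≠ 0 → IsUnit (1 - C 0 0 • RotationSystem.faceMatrix δ f (-C.det))) ∧
      RotationSystem.faceScattering C δ (-C.det) f ∈ Matrix.unitaryGroup _ ℂ := fun f => by
    have hP := RotationSystem.faceMatrix_mem_unitaryGroup (δ := δ) hω f
    have hu := fun h => Matrix.isUnit_one_sub_smul_of_mem_unitaryGroup hP (Matrix.coin_norm_lt hC h)
    exact ⟨hP, hu, Matrix.moebius_mem_unitaryGroup hP hd' hω ha hk hu hd0⟩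
  refine ⟨hface, RotationSystem.isScatteringMatrix_iff hC hd', fun hδ => ?_⟩
  have hP := fun f =>
    RotationSystem.faceMatrix_eq_smul_hedgehogMatrix (R := R) hδ f (-C.det)
  have hS : ∀ f : R.Face, (C 0 1 * C 1 0 * -C.det) • (RotationSystem.hedgehogMatrix δ f *
      (1 - (C 0 0 * -C.det) • RotationSystem.hedgehogMatrix δ f)⁻¹) + C 1 1 • 1 =
      RotationSystem.faceScattering C δ (-C.det) f := fun f => by
    rw [RotationSystem.faceScattering, hP, smul_smul, smul_mul_assoc, smul_smul]
  simp only [hS]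
  refine ⟨fun f => ⟨?_, fun h => ?_, (hface f).2.2⟩, RotationSystem.isScatteringMatrix_iff hC hd'⟩
  -- In the hedgehog case `P_f` is the weighted matrix at the parameter value `1`.
  · have h1 := RotationSystem.faceMatrix_mem_unitaryGroup (δ := δ) (ω := 1) (by simp) f
    rwa [RotationSystem.faceMatrix_eq_smul_hedgehogMatrix hδ, one_smul] at h1
  · have h1 := (hface f).2.1 h
    rwa [hP, smul_smul] at h1
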